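/- Let $M$ be a closed (compact, without boundary) smooth Riemannian manifold of dimension $d\ge 2$, with Riemannian volume measure $\mathrm{vol}_M$, and let $B_r(0)$ be the open ball of radius $r$ in $\mathbb R^d$. *Perturbations.* Let $d'=d^2+d-1$. A parameter $a\in\mathbb R^{d'}$ consists of a vector $b_a\in\mathbb R^d$ and of all entries, except the one at place $(1,1)$, of a $d\times d$ matrix; $A'_a$ denotes the trace-free matrix with these entries, and $A_a=\exp A'_a\in \mathrm{SL}_d(\mathbb R)$. Let $W\subset\mathbb R^{d'}$ be an open set of parameters such that for $a\in W$ there is $b'_a\in\mathbb R^d$ with $\exp\begin{pmatrix}A'_a&b'_a\\0&0\end{pmatrix}=\begin{pmatrix}A_a&b_a\\0&1\end{pmatrix}$, and put $X_a(y)=A'_ay+b'_a$. Fix $R>1$, and let $\omega_0=dx_1\wedge\cdots\wedge dx_d$. Let $\chi_a$ ($a\in W$) be $(d-2)$-forms on $B_R(0)$, smooth in $(a,y)$, with $d\chi_a=\iota_{X_a}\omega_0$, and let $f:\mathbb R^d\to[0,1]$ be smooth, equal to $1$ on $B_1(0)$ and to $0$ outside a ball $B_r(0)$ with $r<R$. Let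 $Y_a$ be the vector field on $\mathbb R^d$ with $\iota_{Y_a}\omega_0=d(f\chi_a)$ (zero outside $B_r(0)$), and let $\psi^a_1$ be the time-one map of its flow. Let $\phi_i:U'_i\to B_R(0)$, $i=1,\dots,j$, be smooth charts of $M$ onto $B_R(0)$, centred at points $x_i$ (so $\phi_i(x_i)=0$), each of which carries $\mathrm{vol}_M$ to a positive constant multiple of Lebesgue measure, and suppose that the sets $U_i=\phi_i^{-1}(B_{1/2}(0))$ cover $M$. For $a\in W$ let $g_i^a$ be the diffeomorphism of $M$ equal to $\phi_i^{-1}\circ\psi_1^a\circ\phi_i$ on $U'_i$ and to the identity outside $U_i'$. *Random walk.* Let $f_0$ be a smooth volume-preserving diffeomorphism of $M$, let $0<\epsilon<1/2$ with $[-\epsilon,\epsilon]^{d'}\subset W$, and let $p_0,\dots,p_j>0$ with $\sum_{i=0}^jp_i=1$. Let $$\mu=C\Big(p_0\delta_{f_0}+\sum_{i=1}^jp_i\int_{[-\epsilon,\epsilon]^{d'}}\delta_{g_i^a\circ f_0}\,da\Big),$$ where $C>0$ makes $\mu$ a probability measure on $\mathrm{Diff}^\infty(M)$. *Invariant conformal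 structures.* A conformal structure on a real vector space is an inner product up to multiplication by positive scalars; $\mathbf{CS}(TM)$ is the bundle over $M$ of the conformal structures on the spaces $T_xM$. For a probability measure $\nu$ on $M$, a $\mu$-invariant $\nu$-measurable conformal structure on $TM$ is a $\nu$-measurable section $x\mapsto C_x$ of $\mathbf{CS}(TM)$ such that for $\nu$-a.e. $x\in M$ and $\mu$-a.e. $f$ one has $C_{f(x)}=D_xf\,C_x$. **Theorem.** Let $\nu$ be a $\mu$-stationary Borel probability measure on $M$ (that is, $\mu*\nu=\nu$), and suppose that $\nu=\nu_0+\nu_\perp$ with positive measures $\nu_0,\nu_\perp$ such that $\nu_0\ne0$ and $\nu_0\ll\mathrm{vol}_M$. Then there is no $\mu$-invariant $\nu$-measurable conformal structure on $TM$. -/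

import Mathlib

open scoped Manifold ContDiff Matrix ENNReal NNReal
open MeasureTheory Set

noncomputable section

namespace RandomWalk

/-- The Euclidean space `ℝ^d`, on which the `d`-dimensional manifolds are modelled. -/
abbrev Euc (d : ℕ) : Type := EuclideanSpace ℝ (Fin d)

/-! ### Conformal structures -/

section Conformal

/-- The inner products (symmetric positive definite bilinear forms) on a real vector space `V`. -/
def InnerForm (V : Type*) [AddCommGroup V] [Module ℝ V] [TopologicalSpace V]
    [IsTopologicalAddGroup V] [ContinuousSMul ℝ V] : Type _ :=
  {B : V →L[ℝ] V →L[ℝ] ℝ // (∀ v w, B v w = B w v) ∧ ∀ v, v ≠ 0 → 0 < B v v}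

/-- The topology of the space of inner products, as a subspace of the space of bilinear forms. -/
instance (V : Type*) [AddCommGroup V] [Module ℝ V] [TopologicalSpace V]
    [IsTopologicalAddGroup V] [ContinuousSMul ℝ V] : TopologicalSpace (InnerForm V) :=
  inferInstanceAs (TopologicalSpace
    {B : V →L[ℝ] V →L[ℝ] ℝ // (∀ v w, B v w = B w v) ∧ ∀ v, v ≠ 0 → 0 < B v v})

/-- Two inner products are conformally equivalent when they are positive multiples of each other. -/
def conformalSetoid (V : Type*) [AddCommGroup V] [Module ℝ V] [TopologicalSpace V]
    [IsTopologicalAddGroup V] [ContinuousSMul ℝ V] : Setoid (InnerForm V) where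
  r B B' := ∃ c : ℝ, 0 < c ∧ ∀ v w, B'.1 v w = c * B.1 v w
  iseqv :=
    { refl := fun B => ⟨1, one_pos, fun v w => by simp⟩
      symm := by
        rintro B B' ⟨c, hc, h⟩
        exact ⟨c⁻¹, inv_pos.2 hc, fun v w => by rw [h, inv_mul_cancel_left₀ hc.ne']⟩
      trans := by
        rintro B B' B'' ⟨c, hc, h⟩ ⟨c', hc', h'⟩
        exact ⟨c' * c, mul_pos hc' hc, fun v w => by rw [h', h, mul_assoc]⟩ }

/-- The space `CS(V)` of conformal structures on `V`: inner products up to positive scaling. -/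
def CS (V : Type*) [AddCommGroup V] [Module ℝ V] [TopologicalSpace V]
    [IsTopologicalAddGroup V] [ContinuousSMul ℝ V] : Type _ :=
  Quotient (conformalSetoid V)

/-- The quotient topology on `CS(V)`. -/
instance (V : Type*) [AddCommGroup V] [Module ℝ V] [TopologicalSpace V]
    [IsTopologicalAddGroup V] [ContinuousSMul ℝ V] : TopologicalSpace (CS V) :=
  inferInstanceAs (TopologicalSpace (Quotient (conformalSetoid V)))

/-- The Borel σ-algebra of `CS(V)`. -/
instance (V : Type*) [AddCommGroup V] [Module ℝ V] [TopologicalSpace V]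
    [IsTopologicalAddGroup V] [ContinuousSMul ℝ V] : MeasurableSpace (CS V) := borel _

variable {V W : Type*}
  [AddCommGroup V] [Module ℝ V] [TopologicalSpace V] [IsTopologicalAddGroup V] [ContinuousSMul ℝ V]
  [AddCommGroup W] [Module ℝ W] [TopologicalSpace W] [IsTopologicalAddGroup W] [ContinuousSMul ℝ W]

/-- The push-forward `(v, w) ↦ B (L⁻¹ v) (L⁻¹ w)` of an inner product under an isomorphism `L`. -/
def InnerForm.push (L : V ≃L[ℝ] W) (B : InnerForm V) : InnerForm W :=
  ⟨(ContinuousLinearMap.precomp ℝ (L.symm : W →L[ℝ] V)).comp (B.1.comp (L.symm : W →L[ℝ] V)),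
    fun v w => by simpa using B.2.1 _ _,
    fun v hv => by simpa using B.2.2 (L.symm v) (by simpa using hv)⟩

/-- The action of a linear isomorphism on conformal structures. -/
def CS.push (L : V ≃L[ℝ] W) : CS V → CS W :=
  Quotient.map (InnerForm.push L) (by
    rintro B B' ⟨c, hc, h⟩
    exact ⟨c, hc, fun v w => by simpa [InnerForm.push] using h (L.symm v) (L.symm w)⟩)

end Conformal

/-! ### The manifold: volume, diffeomorphisms, stationary measures, invariant structures -/

section Manifold

/-- The smooth diffeomorphisms of the `d`-dimensional manifold `M`. -/
abbrev Diff (d : ℕ) (M : Type*) [TopologicalSpace M] [ChartedSpace (Euc d) M] : Type _ :=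
  M ≃ₘ^∞⟮𝓡 d, 𝓡 d⟯ M

/-- A smooth Riemannian metric on the `d`-dimensional manifold `M`. -/
abbrev Metric (d : ℕ) (M : Type*) [TopologicalSpace M] [ChartedSpace (Euc d) M]
    [IsManifold (𝓡 d) ∞ M] : Type _ :=
  Bundle.ContMDiffRiemannianMetric (𝓡 d) ∞ (Euc d) (fun x : M => TangentSpace (𝓡 d) x)

variable {d : ℕ} {M : Type*} [TopologicalSpace M] [ChartedSpace (Euc d) M]
  [IsManifold (𝓡 d) ∞ M] [MeasurableSpace M] [BorelSpace M]

/-- The Gram matrix at `x` of the Riemannian metric in the coordinate frame of the preferred chart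
at `p`. -/
def gram (g : Metric d M) (p x : M) : Matrix (Fin d) (Fin d) ℝ := fun i j =>
  let e := trivializationAt (Euc d) (fun y : M => TangentSpace (𝓡 d) y) p
  g.inner x (e.symmL ℝ x (EuclideanSpace.single i 1)) (e.symmL ℝ x (EuclideanSpace.single j 1))

/-- The Riemannian volume of (the domain of) the preferred chart at `p`: the measure
`√det(g_ij) dx_1 ⋯ dx_d`, transported to `M`. -/
def chartVolume (g : Metric d M) (p : M) : Measure M :=
  ((volume.restrict (chartAt (Euc d) p).target).withDensity fun y =>
    ENNReal.ofReal (Real.sqrt (gram g p ((chartAt (Euc d) p).symm y)).det)).map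
    (chartAt (Euc d) p).symm

/-- The Riemannian volume measure. The measures `chartVolume g p` are the restrictions of one and
the same measure to the (open) chart domains, which cover `M`; so their supremum in the lattice of
measures is that measure. -/
def vol (g : Metric d M) : Measure M := ⨆ p : M, chartVolume g p

/-- The σ-algebra on the group of diffeomorphisms that is generated by the evaluations
`f ↦ f x`. For compact `M` the group is Polish in the `C^∞` topology and countably many continuous
evaluations separate its points, so this is the Borel σ-algebra of the `C^∞` topology. -/
instance : MeasurableSpace (Diff d M) :=
  ⨆ x : M, MeasurableSpace.comap (fun f : Diff d M => f x) inferInstance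

/-- The convolution `μ ∗ ν`: the law of `f x` for independent `f` of law `μ`, `x` of law `ν`. -/
def conv (μ : Measure (Diff d M)) (ν : Measure M) : Measure M :=
  (μ.prod ν).map fun q => q.1 q.2

/-- `ν` is a `μ`-stationary probability measure. -/
def IsStationary (μ : Measure (Diff d M)) (ν : Measure M) : Prop :=
  IsProbabilityMeasure ν ∧ ν = conv μ ν

/-- A section `C` of the bundle `CS(TM)` is `ν`-measurable: in each of the local trivializations
of `TM` over the chart domains, it is a `ν`-measurable map into `CS(ℝ^d)`. -/
def IsMeasurableSection (ν : Measure M) (C : (x : M) → CS (TangentSpace (𝓡 d) x)) : Prop :=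
  ∀ p : M,
    let e := trivializationAt (Euc d) (fun y : M => TangentSpace (𝓡 d) y) p
    AEMeasurable (fun x : e.baseSet => CS.push (e.continuousLinearEquivAt ℝ x.1 x.2) (C x.1))
      (ν.comap Subtype.val)

/-- The derivative `D_x f : T_x M → T_{f x} M` of a diffeomorphism. -/
def deriv (f : Diff d M) (x : M) : TangentSpace (𝓡 d) x ≃L[ℝ] TangentSpace (𝓡 d) (f x) :=
  f.mfderivToContinuousLinearEquiv (by simp) x

/-- `C` is a `μ`-invariant `ν`-measurable conformal structure on `TM`. -/
def IsInvariantConformalStructure (μ : Measure (Diff d M)) (ν : Measure M)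
    (C : (x : M) → CS (TangentSpace (𝓡 d) x)) : Prop :=
  IsMeasurableSection ν C ∧ ∀ᵐ x ∂ν, ∀ᵐ f ∂μ, C (f x) = CS.push (deriv f x) (C x)

end Manifold

/-! ### The affine perturbations, in dimension `d = n + 2` -/

section Construction

/-- The parameters `a`: a translation vector in `ℝ^d` together with all the entries but the first
one (at place `(0, 0)`) of a `d × d` matrix; so there are `d + (d² - 1)` of them. -/
abbrev Param (d : ℕ) [NeZero d] : Type :=
  (Fin d → ℝ) × ({q : Fin d × Fin d // q ≠ (0, 0)} → ℝ)

/-- The cube `[-ε, ε]^{d² + d - 1}` of parameters. -/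
def cube (d : ℕ) [NeZero d] (ε : ℝ) : Set (Param d) :=
  {a | (∀ i, |a.1 i| ≤ ε) ∧ ∀ q, |a.2 q| ≤ ε}

/-- The trace-free matrix `A'_a`: its entries other than the first one are the given parameters. -/
def linPart {d : ℕ} [NeZero d] (a : Param d) : Matrix (Fin d) (Fin d) ℝ := fun i j =>
  if h : (i, j) ≠ (0, 0) then a.2 ⟨(i, j), h⟩
  else - ∑ k : {k : Fin d // k ≠ 0}, a.2 ⟨(k.1, k.1), fun h => k.2 (congrArg Prod.fst h)⟩

/-- The `(d + 1) × (d + 1)` matrix with blocks `A`, `b` in the first row, and `0`, `s` in the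
second one. -/
def blockMatrix {d : ℕ} (A : Matrix (Fin d) (Fin d) ℝ) (b : Fin d → ℝ) (s : ℝ) :
    Matrix (Fin d ⊕ Unit) (Fin d ⊕ Unit) ℝ :=
  Matrix.fromBlocks A (Matrix.replicateCol Unit b) 0 (Matrix.of fun _ _ => s)

/-- The affine vector field `y ↦ A y + b` on `ℝ^d`. -/
def affineField {d : ℕ} (A : Matrix (Fin d) (Fin d) ℝ) (b : Fin d → ℝ) (y : Euc d) : Euc d :=
  WithLp.toLp 2 (A *ᵥ y.ofLp + b)

/-- The standard volume form `dx_1 ∧ ⋯ ∧ dx_d` of `ℝ^d`. -/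
def stdForm {d : ℕ} (v : Fin d → Euc d) : ℝ := (Matrix.of fun i j => v i j).det

/-- A choice of the data in the construction of the volume preserving perturbations `g_i^a` of the
identity on the closed Riemannian manifold `M` of dimension `n + 2`. The parameter `a` ranges over
an open set `dom`, on which the logarithm of the affine maps has to be defined. -/
structure Perturbations {n : ℕ} {M : Type*} [TopologicalSpace M] [ChartedSpace (Euc (n + 2)) M]
    [IsManifold (𝓡 (n + 2)) ∞ M] [MeasurableSpace M] [BorelSpace M] (g : Metric (n + 2) M) where
  /-- The number of charts. -/
  j : ℕ
  /-- The radius of the ball onto which the charts map. -/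
  R : ℝ
  one_lt_R : 1 < R
  /-- The centres of the charts. -/
  pt : Fin j → M
  /-- The charts `φ_i : U'_i → B_R(0)`. -/
  φ : Fin j → OpenPartialHomeomorph M (Euc (n + 2))
  φ_smooth : ∀ i, φ i ∈ IsManifold.maximalAtlas (𝓡 (n + 2)) ∞ M
  φ_target : ∀ i, (φ i).target = Metric.ball 0 R
  pt_mem : ∀ i, pt i ∈ (φ i).source
  φ_pt : ∀ i, φ i (pt i) = 0
  /-- In the chart, the volume of `M` is a constant multiple of Lebesgue measure. -/
  φ_volume : ∀ i, ∃ c : ℝ≥0, 0 < c ∧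
    ((vol g).restrict (φ i).source).map (φ i) = c • volume.restrict (Metric.ball 0 R)
  /-- The sets `U_i = φ_i⁻¹(B_{1/2}(0))` cover `M`. -/
  cover : ∀ x : M, ∃ i, x ∈ (φ i).source ∧ φ i x ∈ Metric.ball (0 : Euc (n + 2)) (1 / 2)
  /-- The set of admissible parameters. -/
  dom : Set (Param (n + 2))
  dom_open : IsOpen dom
  /-- The translation part `b'_a` of the logarithm of the affine map. -/
  b' : Param (n + 2) → Fin (n + 2) → ℝ
  /-- The exponential of `X_a = (A'_a, b'_a; 0, 0)` is `(A_a, b_a; 0, 1)`, where `A_a = exp A'_a`,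
  and `b_a` is the vector of the first `d` parameters. -/
  exp_eq : ∀ a ∈ dom, NormedSpace.exp (blockMatrix (linPart a) (b' a) 0) =
    blockMatrix (NormedSpace.exp (linPart a)) a.1 1
  /-- The `(d - 2)`-forms `χ_a` on `B_R(0)`, smooth in `a` and in the point. -/
  χ : Param (n + 2) → Euc (n + 2) → (Euc (n + 2) [⋀^Fin n]→L[ℝ] ℝ)
  χ_smooth : ContDiffOn ℝ ∞ (fun q : Param (n + 2) × Euc (n + 2) => χ q.1 q.2)
    (dom ×ˢ Metric.ball 0 R)
  /-- `dχ_a = ι_{X_a} ω` on `B_R(0)`. -/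
  dχ : ∀ a ∈ dom, ∀ y ∈ Metric.ball (0 : Euc (n + 2)) R, ∀ v : Fin (n + 1) → Euc (n + 2),
    extDeriv (χ a) y v = stdForm (Fin.cons (affineField (linPart a) (b' a) y) v)
  /-- The bump function, extended by zero to `ℝ^d`. -/
  bump : Euc (n + 2) → ℝ
  bump_smooth : ContDiff ℝ ∞ bump
  bump_mem : ∀ y, bump y ∈ Icc (0 : ℝ) 1
  bump_one : ∀ y ∈ Metric.ball (0 : Euc (n + 2)) 1, bump y = 1
  bump_zero : ∃ r < R, ∀ y ∉ Metric.ball (0 : Euc (n + 2)) r, bump y = 0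
  /-- The vector fields `Y_a`, given by `ι_{Y_a} ω = d(f χ_a)`, where `f` is the bump function. -/
  Y : Param (n + 2) → Euc (n + 2) → Euc (n + 2)
  Y_eq : ∀ a ∈ dom, ∀ y, ∀ v : Fin (n + 1) → Euc (n + 2),
    stdForm (Fin.cons (Y a y) v) = extDeriv (fun z => bump z • χ a z) y v
  /-- The flow of `Y_a`; its time one map is `ψ_1^a`. -/
  ψ : Param (n + 2) → ℝ → Euc (n + 2) → Euc (n + 2)
  ψ_zero : ∀ a ∈ dom, ∀ y, ψ a 0 y = y
  ψ_deriv : ∀ a ∈ dom, ∀ y t, HasDerivAt (fun s => ψ a s y) (Y a (ψ a t y)) t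
  /-- The diffeomorphisms `g_i^a` of `M`. -/
  diffeo : Fin j → Param (n + 2) → Diff (n + 2) M
  diffeo_chart : ∀ i, ∀ a ∈ dom, ∀ x ∈ (φ i).source,
    diffeo i a x = (φ i).symm (ψ a 1 (φ i x))
  diffeo_off : ∀ i, ∀ a ∈ dom, ∀ x ∉ (φ i).source, diffeo i a x = x

variable {n : ℕ} {M : Type*} [TopologicalSpace M] [ChartedSpace (Euc (n + 2)) M]
  [IsManifold (𝓡 (n + 2)) ∞ M] [MeasurableSpace M] [BorelSpace M] {g : Metric (n + 2) M}

/-- The measure `p_0 δ_{f_0} + ∑_i p_i ∫_{[-ε, ε]^{d² + d - 1}} δ_{g_i^a ∘ f_0} da`. -/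
def unnormalizedLaw (P : Perturbations g) (f₀ : Diff (n + 2) M) (ε : ℝ) (p₀ : ℝ≥0)
    (p : Fin P.j → ℝ≥0) : Measure (Diff (n + 2) M) :=
  p₀ • Measure.dirac f₀ + ∑ i, p i •
    (volume.restrict (cube (n + 2) ε)).map fun a => f₀.trans (P.diffeo i a)

/-- The law `μ` of the random walk: the measure above, normalized to a probability measure. -/
def law (P : Perturbations g) (f₀ : Diff (n + 2) M) (ε : ℝ) (p₀ : ℝ≥0)
    (p : Fin P.j → ℝ≥0) : Measure (Diff (n + 2) M) :=
  (unnormalizedLaw P f₀ ε p₀ p univ)⁻¹ • unnormalizedLaw P f₀ ε p₀ p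

end Construction

end RandomWalk

end

noncomputable section

namespace RandomWalk

open Filter Topology

/-! Choose one point x at which C(f x) = D_x f C_x for almost every f, and a chart φ_i with f₀ x in
U_i. Put y = φ_i(f₀ x), and let c be the image of C_x under D f₀, read in the chart. A small
perturbation g_i^a is the affine map v ↦ A_a v + b_a in the chart near y, so the section K read in
the chart satisfies K(A_a y + b_a) = A_a c for almost every small a.

The matrix A_a depends only on the matrix parameters s, and the translation b_a is free. Passing
from b_a to z = A_a y + b_a is a shear of the parameter space that preserves Lebesgue measure, so
Fubini gives a single z with K(z) = A_s c for almost every small s (`not_ae_affine_equivariant`). By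
continuity, all small s then move c to the same structure. This is absurd: a unipotent matrix fixing
e₀ would have to rescale the inner product by 1, yet it changes the product of e₁ and e₀
(`not_ae_push_expEquiv_eq`).

The affine form holds because, for small a, trajectories from B_{1/2}(0) stay up to time one in the
unit ball, where Y_a = X_a (`Perturbations.eventually_ψ_one_eq`).
`not_isInvariantConformalStructure_law` combines the two halves. -/

/-! ### The standard volume form -/

/-- The coordinates of a vector are recovered from its contractions with the volume form. -/
theorem exists_coord_eq_stdForm {n : ℕ} (i : Fin (n + 1)) :
    ∃ (v : Fin n → Euc (n + 1)) (c : ℝ), ∀ u : Euc (n + 1), u i = c * stdForm (Fin.cons u v) := by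
  -- Contract with the basis vectors other than the i-th: in the expansion along the row of u, only
  -- the minor of column i survives, with sign (-1)^i.
  refine ⟨fun k => EuclideanSpace.single (i.succAbove k) 1, (-1) ^ (i : ℕ), fun u => ?_⟩
  unfold stdForm
  rw [Matrix.det_succ_row_zero, Finset.sum_eq_single i]
  · have h : ((Matrix.of fun a b => (Fin.cons u (fun k => EuclideanSpace.single (i.succAbove k) 1) :
        Fin (n + 1) → Euc (n + 1)) a b).submatrix Fin.succ i.succAbove) =
        (1 : Matrix (Fin n) (Fin n) ℝ) := by
      ext a b
      simp [Matrix.one_apply, eq_comm]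
    rw [h]
    simp [← mul_assoc, ← mul_pow]
  · intro j _ hj
    obtain ⟨l, hl⟩ := Fin.exists_succAbove_eq hj.symm
    have : ((Matrix.of fun a b => (Fin.cons u (fun k => EuclideanSpace.single (i.succAbove k) 1) :
        Fin (n + 1) → Euc (n + 1)) a b).submatrix Fin.succ j.succAbove).det = 0 :=
      Matrix.det_eq_zero_of_column_eq_zero l fun a => by
        simp [hl, (Fin.succAbove_ne i a).symm]
    rw [this, mul_zero]
  · simp

theorem eq_of_stdForm_cons_eq {n : ℕ} {u w : Euc (n + 1)}
    (h : ∀ v : Fin n → Euc (n + 1), stdForm (Fin.cons u v) = stdForm (Fin.cons w v)) : u = w := by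
  ext i
  obtain ⟨v, c, hv⟩ := exists_coord_eq_stdForm i
  rw [hv u, hv w, h]

/-! ### Flows of globally Lipschitz vector fields and of linear ones -/

section Flow

variable {E : Type*} [NormedAddCommGroup E] [NormedSpace ℝ E]

/-- A trajectory of a globally Lipschitz vector field is constant if it ever meets a zero. -/
theorem trajectory_eq_of_zero {K : ℝ≥0} {F : E → E} (hF : LipschitzWith K F) {u : ℝ → E}
    (hu : ∀ t, HasDerivAt u (F (u t)) t) {s : ℝ} (hs : F (u s) = 0) (t : ℝ) : u t = u s := by
  have := ODE_solution_unique_univ (v := fun _ => F) (s := fun _ => univ) (K := K) (t₀ := s)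
    (f := u) (g := fun _ => u s) (fun _ => hF.lipschitzOnWith)
    (fun t => ⟨hu t, mem_univ _⟩)
    (fun t => ⟨by rw [hs]; exact hasDerivAt_const t (u s), mem_univ _⟩) rfl
  exact congrFun this t

/-- Gronwall's inequality, for trajectories of two vector fields that are uniformly close. -/
theorem dist_trajectories_le {K : ℝ≥0} {F G : E → E} (hF : LipschitzWith K F) {η : ℝ}
    (hG : ∀ y, dist (G y) (F y) ≤ η) {u w : ℝ → E} (hu : ∀ t, HasDerivAt u (G (u t)) t)
    (hw : ∀ t, HasDerivAt w (F (w t)) t) (h0 : u 0 = w 0) {t : ℝ} (ht : t ∈ Icc (0 : ℝ) 1) :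
    dist (u t) (w t) ≤ gronwallBound 0 K η 1 := by
  have hη : 0 ≤ η := dist_nonneg.trans (hG (u 0))
  have := dist_le_of_approx_trajectories_ODE (v := fun _ => F) (K := K) (a := 0) (b := 1)
    (f := u) (g := w) (f' := fun t => G (u t)) (g' := fun t => F (w t)) (εf := η) (εg := 0) (δ := 0)
    (fun _ => hF) (fun t _ => (hu t).continuousAt.continuousWithinAt)
    (fun t _ => (hu t).hasDerivWithinAt) (fun t _ => hG _)
    (fun t _ => (hw t).continuousAt.continuousWithinAt)
    (fun t _ => (hw t).hasDerivWithinAt) (fun t _ => (dist_self _).le) (by rw [h0, dist_self]) t ht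
  refine this.trans ?_
  rw [add_zero, sub_zero]
  exact gronwallBound_mono le_rfl hη K.2 ht.2

end Flow

open scoped Matrix.Norms.Operator in
/-- The solutions of a linear differential equation are given by the matrix exponential. -/
theorem eq_exp_mulVec_of_hasDerivAt {m : Type*} [Fintype m] [DecidableEq m] (B : Matrix m m ℝ)
    {w : ℝ → m → ℝ} (hw : ∀ t ∈ Icc (0 : ℝ) 1, HasDerivAt w (B *ᵥ w t) t) :
    w 1 = NormedSpace.exp B *ᵥ w 0 := by
  set L : (m → ℝ) →L[ℝ] (m → ℝ) := LinearMap.toContinuousLinearMap B.mulVecLin with hL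
  have hLa : ∀ v, L v = B *ᵥ v := fun v => rfl
  set T : Matrix m m ℝ →L[ℝ] (m → ℝ) := LinearMap.toContinuousLinearMap
    ((Matrix.mulVecBilin ℝ ℝ).flip (w 0)) with hT
  have hTa : ∀ X, T X = X *ᵥ w 0 := fun X => rfl
  have h1 : ∀ t : ℝ, HasDerivAt (fun t : ℝ => T (NormedSpace.exp (t • B)))
      (L (T (NormedSpace.exp (t • B)))) t := fun t => by
    have := T.hasFDerivAt.comp_hasDerivAt t (hasDerivAt_exp_smul_const' (𝕂 := ℝ) B t)
    have e : L (T (NormedSpace.exp (t • B))) = T (B * NormedSpace.exp (t • B)) :=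
      Matrix.mulVec_mulVec _ _ _
    rw [e]
    exact this
  have := ODE_solution_unique_of_mem_Icc_right (v := fun _ => L) (s := fun _ => univ) (a := 0) (b := 1)
    (K := ‖L‖₊) (f := w) (g := fun t : ℝ => T (NormedSpace.exp (t • B)))
    (fun _ _ => L.lipschitz.lipschitzOnWith)
    (fun t ht => (hw t ht).continuousAt.continuousWithinAt)
    (fun t ht => (hw t (Ico_subset_Icc_self ht)).hasDerivWithinAt) (fun _ _ => mem_univ _)
    (fun t _ => (h1 t).continuousAt.continuousWithinAt)
    (fun t _ => (h1 t).hasDerivWithinAt) (fun _ _ => mem_univ _)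
    (by simp [hTa]) (right_mem_Icc.2 zero_le_one)
  simpa [hTa] using this

/-! ### The perturbing flows -/

namespace Perturbations

variable {n : ℕ} {M : Type*} [TopologicalSpace M] [ChartedSpace (Euc (n + 2)) M]
  [IsManifold (𝓡 (n + 2)) ∞ M] [MeasurableSpace M] [BorelSpace M] {g : Metric (n + 2) M}
  (P : Perturbations g)

/-- The cut-off forms are smooth in the parameter and in the point. -/
theorem contDiffAt_bump_smul_χ {a : Param (n + 2)} (ha : a ∈ P.dom) (y : Euc (n + 2)) :
    ContDiffAt ℝ ∞ (fun q : Param (n + 2) × Euc (n + 2) => P.bump q.2 • P.χ q.1 q.2) (a, y) := by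
  obtain ⟨r, hr, hb⟩ := P.bump_zero
  by_cases hy : y ∈ Metric.ball (0 : Euc (n + 2)) P.R
  · exact (P.bump_smooth.contDiffAt.comp (a, y) contDiffAt_snd).smul
      (P.χ_smooth.contDiffAt ((P.dom_open.prod Metric.isOpen_ball).mem_nhds ⟨ha, hy⟩))
  -- Nothing is known of χ outside the ball of radius R, but since r < R the cut-off vanishes near
  -- such a point.
  · have hy' : y ∉ Metric.closedBall (0 : Euc (n + 2)) r := fun h =>
      hy (Metric.closedBall_subset_ball hr h)
    have : ∀ᶠ q : Param (n + 2) × Euc (n + 2) in 𝓝 (a, y),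
        P.bump q.2 • P.χ q.1 q.2 = 0 := by
      have h1 : ∀ᶠ q : Param (n + 2) × Euc (n + 2) in 𝓝 (a, y),
          q.2 ∉ Metric.closedBall (0 : Euc (n + 2)) r :=
        (continuous_snd.tendsto (a, y)).eventually
          (Metric.isClosed_closedBall.isOpen_compl.eventually_mem hy')
      filter_upwards [h1] with q hq
      rw [hb _ fun h => hq (Metric.ball_subset_closedBall h), zero_smul]
    exact (contDiffAt_const (c := 0)).congr_of_eventuallyEq this

/-- The vector fields are continuously differentiable in the parameter and in the point. -/
theorem contDiffAt_Y {a : Param (n + 2)} (ha : a ∈ P.dom) (y : Euc (n + 2)) :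
    ContDiffAt ℝ 1 (fun q : Param (n + 2) × Euc (n + 2) => P.Y q.1 q.2) (a, y) := by
  have hd : ContDiffAt ℝ 1 (fun q : Param (n + 2) × Euc (n + 2) =>
      fderiv ℝ (fun z => P.bump z • P.χ q.1 z) q.2) (a, y) := by
    refine ContDiffAt.fderiv (n := ∞)
      (f := fun (q : Param (n + 2) × Euc (n + 2)) z => P.bump z • P.χ q.1 z)
      (g := fun q => q.2) ?_ contDiffAt_snd (by norm_cast)
    exact (P.contDiffAt_bump_smul_χ ha y).comp ((a, y), y)
      ((contDiffAt_fst.comp _ contDiffAt_fst).prodMk contDiffAt_snd)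
  rw [contDiffAt_euclidean]
  intro i
  obtain ⟨v, c, hv⟩ := exists_coord_eq_stdForm i
  have hs : ContDiffAt ℝ 1 (fun q : Param (n + 2) × Euc (n + 2) => c *
      extDeriv (fun z => P.bump z • P.χ q.1 z) q.2 v) (a, y) := by
    have h1 := (ContinuousAlternatingMap.alternatizeUncurryFinCLM ℝ (Euc (n + 2))
      ℝ (n := n)).contDiff.contDiffAt.comp (a, y) hd
    exact contDiffAt_const.mul
      ((ContinuousAlternatingMap.apply ℝ (Euc (n + 2)) ℝ v).contDiff.contDiffAt.comp (a, y) h1)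
  refine hs.congr_of_eventuallyEq ?_
  -- The equation defining Y holds only for parameters in `dom`; openness makes this enough near a.
  filter_upwards [continuous_fst.continuousAt.eventually (P.dom_open.mem_nhds ha)] with q hq
  rw [hv, P.Y_eq _ hq]

/-- Off the closed ball the cut-off form vanishes on a whole neighbourhood, hence so does its
exterior derivative. -/
theorem Y_eq_zero {r : ℝ} (hb : ∀ y ∉ Metric.ball (0 : Euc (n + 2)) r, P.bump y = 0)
    {a : Param (n + 2)} (ha : a ∈ P.dom) {y : Euc (n + 2)}
    (hy : y ∉ Metric.closedBall (0 : Euc (n + 2)) r) : P.Y a y = 0 := by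
  have h0 : (fun z => P.bump z • P.χ a z) =ᶠ[𝓝 y] fun _ => 0 := by
    filter_upwards [Metric.isClosed_closedBall.isOpen_compl.mem_nhds hy] with z hz
    rw [hb _ fun h => hz (Metric.ball_subset_closedBall h), zero_smul]
  ext i
  obtain ⟨v, c, hv⟩ := exists_coord_eq_stdForm i
  rw [hv, P.Y_eq a ha, h0.extDeriv_eq, extDeriv, fderiv_fun_const, Pi.zero_apply,
    ← ContinuousAlternatingMap.alternatizeUncurryFinCLM_apply, map_zero]
  simp

theorem Y_eq_affineField {a : Param (n + 2)} (ha : a ∈ P.dom) {y : Euc (n + 2)}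
    (hy : y ∈ Metric.ball (0 : Euc (n + 2)) 1) :
    P.Y a y = affineField (linPart a) (P.b' a) y := by
  have h0 : (fun z => P.bump z • P.χ a z) =ᶠ[𝓝 y] P.χ a := by
    filter_upwards [Metric.isOpen_ball.mem_nhds hy] with z hz
    rw [P.bump_one z hz, one_smul]
  refine eq_of_stdForm_cons_eq fun v => ?_
  rw [P.Y_eq a ha, h0.extDeriv_eq, P.dχ a ha y (Metric.ball_subset_ball P.one_lt_R.le hy)]

/-- The field is C¹ with compact support. The global constant is what the uniqueness and Gronwall
arguments need. -/
theorem exists_lipschitzWith_Y {a : Param (n + 2)} (ha : a ∈ P.dom) :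
    ∃ K, LipschitzWith K (P.Y a) := by
  obtain ⟨r, hr, hb⟩ := P.bump_zero
  have h1 : ContDiff ℝ 1 (P.Y a) := contDiff_iff_contDiffAt.2 fun y =>
    (P.contDiffAt_Y ha y).comp y (contDiffAt_const.prodMk contDiffAt_id)
  exact ContDiff.lipschitzWith_of_hasCompactSupport
    (HasCompactSupport.intro (isCompact_closedBall 0 r) fun y hy => P.Y_eq_zero hb ha hy) h1 (by simp)

/-- The vector fields depend uniformly continuously on the parameter. -/
theorem eventually_dist_Y_le {a₀ : Param (n + 2)} (ha₀ : a₀ ∈ P.dom) {η : ℝ} (hη : 0 < η) :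
    ∀ᶠ a in 𝓝 a₀, ∀ y, dist (P.Y a y) (P.Y a₀ y) ≤ η := by
  obtain ⟨r, hr, hb⟩ := P.bump_zero
  have h1 : ∀ᶠ a in 𝓝 a₀, ∀ y ∈ Metric.closedBall (0 : Euc (n + 2)) r,
      dist (P.Y a y) (P.Y a₀ y) < η := by
    refine (isCompact_closedBall 0 r).eventually_forall_of_forall_eventually fun y _ => ?_
    have hc := (P.contDiffAt_Y ha₀ y).continuousAt
    have hc' : ContinuousAt (fun q : Param (n + 2) × Euc (n + 2) => P.Y a₀ q.2) (a₀, y) :=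
      ContinuousAt.comp (f := fun q : Param (n + 2) × Euc (n + 2) => (a₀, q.2))
        (g := fun q : Param (n + 2) × Euc (n + 2) => P.Y q.1 q.2) hc (by fun_prop)
    have := hc.dist hc'
    exact this.eventually (gt_mem_nhds (by simpa using hη))
  filter_upwards [h1, P.dom_open.mem_nhds ha₀] with a h ha y
  by_cases hy : y ∈ Metric.closedBall (0 : Euc (n + 2)) r
  · exact (h y hy).le
  · rw [P.Y_eq_zero hb ha hy, P.Y_eq_zero hb ha₀ hy, dist_self]
    exact hη.le

/-- The flows depend continuously on the parameter, uniformly in the initial point. -/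
theorem eventually_dist_ψ_le {a₀ : Param (n + 2)} (ha₀ : a₀ ∈ P.dom) {η : ℝ} (hη : 0 < η) :
    ∀ᶠ a in 𝓝 a₀, ∀ y, ∀ t ∈ Icc (0 : ℝ) 1, dist (P.ψ a t y) (P.ψ a₀ t y) < η := by
  obtain ⟨K, hK⟩ := P.exists_lipschitzWith_Y ha₀
  -- With equal initial points, the Gronwall bound tends to 0 with the distance δ between the two
  -- fields.
  have hc : Tendsto (fun δ => gronwallBound 0 K δ 1) (𝓝[>] 0) (𝓝 0) := by
    have := (gronwallBound_continuous_ε 0 K 1).tendsto 0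
    rw [gronwallBound_ε0_δ0] at this
    exact this.mono_left nhdsWithin_le_nhds
  obtain ⟨δ, hδη, hδ⟩ := ((hc.eventually (gt_mem_nhds hη)).and self_mem_nhdsWithin).exists
  filter_upwards [P.eventually_dist_Y_le ha₀ hδ, P.dom_open.mem_nhds ha₀] with a h ha y t ht
  exact (dist_trajectories_le hK h (P.ψ_deriv a ha y) (P.ψ_deriv a₀ ha₀ y)
    (by rw [P.ψ_zero a ha, P.ψ_zero a₀ ha₀]) ht).trans_lt hδη

theorem continuousAt_ψ_one {a : Param (n + 2)} (ha : a ∈ P.dom) (y : Euc (n + 2)) :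
    ContinuousAt (fun a => P.ψ a 1 y) a := by
  rw [Metric.continuousAt_iff']
  intro η hη
  filter_upwards [P.eventually_dist_ψ_le ha hη] with b hb
  exact hb y 1 (right_mem_Icc.2 zero_le_one)

/-- The time one maps preserve the ball `B_R(0)`. -/
theorem ψ_one_mem_ball {a : Param (n + 2)} (ha : a ∈ P.dom) {y : Euc (n + 2)}
    (hy : y ∈ Metric.ball (0 : Euc (n + 2)) P.R) :
    P.ψ a 1 y ∈ Metric.ball (0 : Euc (n + 2)) P.R := by
  obtain ⟨r, hr, hb⟩ := P.bump_zero
  obtain ⟨K, hK⟩ := P.exists_lipschitzWith_Y ha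
  -- An endpoint outside the ball would be a zero of the field, so the trajectory would be constant
  -- and its start would be outside too.
  by_contra h
  have h0 : P.Y a (P.ψ a 1 y) = 0 :=
    P.Y_eq_zero hb ha fun h' => h (Metric.closedBall_subset_ball hr h')
  have := trajectory_eq_of_zero hK (P.ψ_deriv a ha y) h0 0
  rw [P.ψ_zero a ha] at this
  exact h (this ▸ hy)

/-- As long as the trajectory remains in the unit ball, the flow is the one of an affine field. -/
theorem ψ_one_eq {a : Param (n + 2)} (ha : a ∈ P.dom) {y : Euc (n + 2)}
    (hy : ∀ t ∈ Icc (0 : ℝ) 1, P.ψ a t y ∈ Metric.ball (0 : Euc (n + 2)) 1) :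
    P.ψ a 1 y = WithLp.toLp 2 (NormedSpace.exp (linPart a) *ᵥ y.ofLp + a.1) := by
  -- An extra coordinate, constantly 1, turns the affine equation into a linear one.
  have key := eq_exp_mulVec_of_hasDerivAt (blockMatrix (linPart a) (P.b' a) 0)
    (w := fun t => Sum.elim (P.ψ a t y).ofLp fun _ : Unit => (1 : ℝ)) fun t ht => by
      have hd := P.ψ_deriv a ha y t
      rw [P.Y_eq_affineField ha (hy t ht)] at hd
      rw [hasDerivAt_pi]
      rintro (i | i)
      · have := (EuclideanSpace.proj i : Euc (n + 2) →L[ℝ] ℝ).hasFDerivAt.comp_hasDerivAt t hd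
        simpa [blockMatrix, affineField, Matrix.fromBlocks_mulVec, Matrix.mulVec, dotProduct,
          Function.comp_def] using this
      · simpa [blockMatrix, Matrix.fromBlocks_mulVec, Matrix.mulVec, dotProduct] using
          hasDerivAt_const t (1 : ℝ)
  rw [P.exp_eq a ha, P.ψ_zero a ha] at key
  ext i
  simpa [blockMatrix, Matrix.fromBlocks_mulVec, Matrix.mulVec, dotProduct] using
    congrFun key (Sum.inl i)

/-- At the parameter `0`, the points of the unit ball are fixed. -/
theorem ψ_zero_param (h0 : (0 : Param (n + 2)) ∈ P.dom) {y : Euc (n + 2)}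
    (hy : y ∈ Metric.ball (0 : Euc (n + 2)) 1) (t : ℝ) : P.ψ 0 t y = y := by
  obtain ⟨K, hK⟩ := P.exists_lipschitzWith_Y h0
  have hl : linPart (0 : Param (n + 2)) = 0 := by
    ext i j
    simp [linPart]
  -- The exponential of the block matrix with linear part 0 sends (0, 1) to (b', 1), and at the
  -- parameter 0 it is the identity.
  have hb : P.b' 0 = 0 := by
    have h := P.exp_eq 0 h0
    rw [hl, NormedSpace.exp_zero] at h
    have := eq_exp_mulVec_of_hasDerivAt (blockMatrix (0 : Matrix _ _ ℝ) (P.b' 0) 0)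
      (w := fun t => Sum.elim (t • P.b' 0) fun _ : Unit => (1 : ℝ)) fun t ht => by
        rw [hasDerivAt_pi]
        rintro (i | i)
        · simpa [blockMatrix, Matrix.fromBlocks_mulVec, Matrix.mulVec, dotProduct] using
            (hasDerivAt_id t).mul_const (P.b' 0 i)
        · simpa [blockMatrix, Matrix.fromBlocks_mulVec, Matrix.mulVec, dotProduct] using
            hasDerivAt_const t (1 : ℝ)
    rw [h] at this
    ext i
    simpa [blockMatrix, Matrix.fromBlocks_mulVec, Matrix.mulVec, dotProduct] using
      congrFun this (Sum.inl i)
  have hY : P.Y 0 (P.ψ 0 0 y) = 0 := by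
    rw [P.ψ_zero 0 h0, P.Y_eq_affineField h0 hy, hl, hb]
    simp [affineField]
  rw [trajectory_eq_of_zero hK (P.ψ_deriv 0 h0 y) hY t, P.ψ_zero 0 h0]

/-- For small parameters, the time one map is affine and unimodular on the ball `B_{1/2}(0)`. -/
theorem eventually_ψ_one_eq (h0 : (0 : Param (n + 2)) ∈ P.dom) :
    ∀ᶠ a in 𝓝 (0 : Param (n + 2)), ∀ y ∈ Metric.ball (0 : Euc (n + 2)) (1 / 2),
      P.ψ a 1 y = WithLp.toLp 2 (NormedSpace.exp (linPart a) *ᵥ y.ofLp + a.1) := by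
  -- Points of B_{1/2}(0) are fixed at parameter 0; a displacement below 1/2 keeps them in the unit
  -- ball.
  filter_upwards [P.eventually_dist_ψ_le h0 (η := 1 / 2) (by norm_num), P.dom_open.mem_nhds h0]
    with a h ha y hy
  refine P.ψ_one_eq ha fun t ht => ?_
  have h1 := h y t ht
  rw [P.ψ_zero_param h0 (Metric.ball_subset_ball (by norm_num) hy)] at h1
  rw [Metric.mem_ball] at hy ⊢
  linarith [dist_triangle (P.ψ a t y) y 0]

/-- The perturbations depend measurably on the parameter. -/
theorem aemeasurable_diffeo (f₀ : Diff (n + 2) M) {S : Set (Param (n + 2))} (hS : S ⊆ P.dom)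
    (hSm : MeasurableSet S) (i : Fin P.j) :
    AEMeasurable (fun a => f₀.trans (P.diffeo i a)) (volume.restrict S) := by
  refine aemeasurable_restrict_of_measurable_subtype hSm ?_
  refine Measurable.of_comap_le ?_
  change MeasurableSpace.comap _ (⨆ x : M, MeasurableSpace.comap
    (fun f : Diff (n + 2) M => f x) inferInstance) ≤ _
  -- The σ-algebra is generated by evaluations, so it suffices to follow the image of each single
  -- point.
  rw [MeasurableSpace.comap_iSup]
  refine iSup_le fun x => ?_
  rw [MeasurableSpace.comap_comp]
  refine Measurable.comap_le ?_
  change Measurable fun a : S => P.diffeo i a (f₀ x)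
  by_cases hx : f₀ x ∈ (P.φ i).source
  · have h1 : (fun a : S => P.diffeo i a (f₀ x)) =
        fun a : S => (P.φ i).symm (P.ψ a 1 (P.φ i (f₀ x))) :=
      funext fun a => P.diffeo_chart i a (hS a.2) _ hx
    rw [h1]
    refine Continuous.measurable (continuous_iff_continuousAt.2 fun a => ?_)
    refine ContinuousAt.comp (f := fun a : S => P.ψ a 1 (P.φ i (f₀ x))) ?_
      ((P.continuousAt_ψ_one (hS a.2) _).comp continuousAt_subtype_val)
    refine (P.φ i).continuousAt_symm ?_
    rw [P.φ_target]
    exact P.ψ_one_mem_ball (hS a.2) (P.φ_target i ▸ (P.φ i).map_source hx)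
  · have h1 : (fun a : S => P.diffeo i a (f₀ x)) = fun _ => f₀ x :=
      funext fun a => P.diffeo_off i a (hS a.2) _ hx
    rw [h1]
    exact measurable_const

end Perturbations

/-! ### The action of unimodular matrices on conformal structures -/

open scoped Matrix.Norms.Operator in
/-- The exponential of a matrix, as an automorphism of `ℝ^d`. -/
def expEquiv {d : ℕ} (X : Matrix (Fin d) (Fin d) ℝ) : Euc d ≃L[ℝ] Euc d :=
  LinearEquiv.toContinuousLinearEquiv
    { toFun := fun v => WithLp.toLp 2 (NormedSpace.exp X *ᵥ v.ofLp)
      invFun := fun v => WithLp.toLp 2 (NormedSpace.exp (-X) *ᵥ v.ofLp)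
      map_add' := fun v w => by simp [Matrix.mulVec_add]
      map_smul' := fun c v => by simp [Matrix.mulVec_smul]
      left_inv := fun v => by
        simp [Matrix.mulVec_mulVec,
          ← Matrix.exp_add_of_commute (-X) X (Commute.neg_left (Commute.refl X))]
      right_inv := fun v => by
        simp [Matrix.mulVec_mulVec,
          ← Matrix.exp_add_of_commute X (-X) (Commute.neg_right (Commute.refl X))] }

theorem expEquiv_apply {d : ℕ} (X : Matrix (Fin d) (Fin d) ℝ) (v : Euc d) :
    expEquiv X v = WithLp.toLp 2 (NormedSpace.exp X *ᵥ v.ofLp) := rfl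

theorem expEquiv_symm_apply {d : ℕ} (X : Matrix (Fin d) (Fin d) ℝ) (v : Euc d) :
    (expEquiv X).symm v = WithLp.toLp 2 (NormedSpace.exp (-X) *ᵥ v.ofLp) := rfl

/-- When N²v = 0, the curve v + tNv solves u' = Nu. -/
theorem exp_mulVec_of_mulVec_mulVec_eq_zero {m : Type*} [Fintype m] [DecidableEq m]
    (N : Matrix m m ℝ) {v : m → ℝ} (h : N *ᵥ (N *ᵥ v) = 0) :
    NormedSpace.exp N *ᵥ v = v + N *ᵥ v := by
  have := eq_exp_mulVec_of_hasDerivAt N (w := fun t => v + t • (N *ᵥ v)) fun t _ => by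
    rw [Matrix.mulVec_add, Matrix.mulVec_smul, h, smul_zero, add_zero]
    simpa using ((hasDerivAt_id t).smul_const (N *ᵥ v)).const_add v
  simpa using this.symm

section

variable {d : ℕ} [NeZero d]

theorem continuous_linPart : Continuous (linPart : Param d → Matrix (Fin d) (Fin d) ℝ) := by
  refine continuous_pi fun i => continuous_pi fun j => ?_
  unfold linPart
  split_ifs <;> fun_prop

open scoped Matrix.Norms.Operator in
theorem continuous_exp_linPart_mulVec (v : Fin d → ℝ) :
    Continuous fun a : Param d => NormedSpace.exp (linPart a) *ᵥ v :=
  (NormedSpace.exp_continuous.comp continuous_linPart).matrix_mulVec continuous_const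

open scoped Matrix.Norms.Operator in
theorem continuous_expEquiv_linPart_symm (v : Euc d) :
    Continuous fun a : Param d => (expEquiv (linPart a)).symm v :=
  (PiLp.continuous_toLp 2 _).comp
    ((NormedSpace.exp_continuous.comp continuous_linPart.neg).matrix_mulVec continuous_const)

theorem linPart_zero : linPart (0 : Param d) = 0 := by
  ext i j
  simp [linPart]

end

theorem CS.exists_of_push_eq {V W : Type*} [AddCommGroup V] [Module ℝ V] [TopologicalSpace V]
    [IsTopologicalAddGroup V] [ContinuousSMul ℝ V] [AddCommGroup W] [Module ℝ W]
    [TopologicalSpace W] [IsTopologicalAddGroup W] [ContinuousSMul ℝ W] {B : InnerForm V}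
    {T T' : V ≃L[ℝ] W}
    (h : CS.push T (Quotient.mk _ B) = CS.push T' (Quotient.mk _ B)) :
    ∃ k : ℝ, ∀ v w, B.1 (T'.symm v) (T'.symm w) = k * B.1 (T.symm v) (T.symm w) := by
  obtain ⟨k, -, hk⟩ := Quotient.exact h
  exact ⟨k, fun v w => hk v w⟩

theorem CS.push_trans {V W Z : Type*} [AddCommGroup V] [Module ℝ V] [TopologicalSpace V]
    [IsTopologicalAddGroup V] [ContinuousSMul ℝ V] [AddCommGroup W] [Module ℝ W]
    [TopologicalSpace W] [IsTopologicalAddGroup W] [ContinuousSMul ℝ W] [AddCommGroup Z]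
    [Module ℝ Z] [TopologicalSpace Z] [IsTopologicalAddGroup Z] [ContinuousSMul ℝ Z]
    (T : V ≃L[ℝ] W) (T' : W ≃L[ℝ] Z) (c : CS V) :
    CS.push (T.trans T') c = CS.push T' (CS.push T c) := by
  induction c using Quotient.inductionOn with | _ B => rfl

/-- No conformal structure on `ℝ^d` has a constant image under almost all the unimodular matrices
near the identity. -/
theorem not_ae_push_expEquiv_eq {n : ℕ} {U : Set ({q : Fin (n + 2) × Fin (n + 2) // q ≠ (0, 0)} → ℝ)}
    (hU : IsOpen U) (h0 : 0 ∈ U) (c c' : CS (Euc (n + 2))) :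
    ¬ ∀ᵐ s, s ∈ U → CS.push (expEquiv (linPart (0, s))) c = c' := by
  intro h
  induction c using Quotient.inductionOn with | _ B => ?_
  set F : Euc (n + 2) → Euc (n + 2) → ({q : Fin (n + 2) × Fin (n + 2) // q ≠ (0, 0)} → ℝ) → ℝ :=
    fun v w s => B.1 ((expEquiv (linPart (0, s))).symm v) ((expEquiv (linPart (0, s))).symm w)
    with hF
  have hFc : ∀ v w, Continuous (F v w) := fun v w => by
    have h1 : ∀ v : Euc (n + 2), Continuous fun s => (expEquiv (linPart (0, s))).symm v := fun v =>
      (continuous_expEquiv_linPart_symm v).comp (by fun_prop)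
    exact (B.1.continuous.comp (h1 v)).clm_apply (h1 w)
  have hFpos : ∀ {v : Euc (n + 2)}, v ≠ 0 → ∀ s, 0 < F v v s := fun hv s =>
    B.2.2 _ (by simpa using hv)
  -- A reference parameter in the full-measure set, against which all others are compared.
  obtain ⟨s₁, hs₁, hU₁⟩ : ∃ s₁, (s₁ ∈ U → CS.push (expEquiv (linPart (0, s₁)))
      (Quotient.mk _ B) = c') ∧ s₁ ∈ U := by
    by_contra! hcon
    have h2 : U ⊆ {s | ¬ (s ∈ U → CS.push (expEquiv (linPart (0, s))) (Quotient.mk _ B) = c')} :=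
      fun s hs hs' => hcon s hs' hs
    exact (hU.measure_pos volume ⟨0, h0⟩).ne' (measure_mono_null h2 h)
  -- Cross-multiplying eliminates the unknown conformal factor. The resulting identity is continuous
  -- in s, so it extends from almost every s to all of U, in particular to the null set of
  -- parameters used below.
  have hprop : ∀ e v w : Euc (n + 2), ∀ s ∈ U, F v w s * F e e s₁ = F e e s * F v w s₁ := by
    intro e v w
    refine Measure.eqOn_open_of_ae_eq (μ := volume) ?_ hU ((hFc v w).mul continuous_const).continuousOn
      ((hFc e e).mul continuous_const).continuousOn
    refine (ae_restrict_iff' hU.measurableSet).2 ?_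
    filter_upwards [h] with s hs hsU
    obtain ⟨k, hk⟩ := CS.exists_of_push_eq ((hs₁ hU₁).trans (hs hsU).symm)
    have h1 : F v w s = k * F v w s₁ := hk v w
    have h2 : F e e s = k * F e e s₁ := hk e e
    rw [h1, h2]
    ring
  set e₀ : Euc (n + 2) := EuclideanSpace.single 0 1 with he₀
  set e₁ : Euc (n + 2) := EuclideanSpace.single 1 1 with he₁
  have hne : e₀ ≠ 0 := by simp [he₀]
  -- The curve of parameters whose matrix is t E₀₁; its diagonal parameters are 0, hence so is the
  -- corner entry.
  let σ : ℝ → {q : Fin (n + 2) × Fin (n + 2) // q ≠ (0, 0)} → ℝ :=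
    fun t q => if q.1 = (0, 1) then t else 0
  have hσc : Continuous σ := by
    refine continuous_pi fun q => ?_
    dsimp only [σ]
    split_ifs <;> fun_prop
  have hσ0 : σ 0 = 0 := by
    ext q
    simp [σ]
  have hev : ∀ᶠ t in 𝓝[≠] (0 : ℝ), σ t ∈ U :=
    (hσc.continuousAt.mono_left nhdsWithin_le_nhds).eventually
      (hU.mem_nhds (by rw [hσ0]; exact h0))
  obtain ⟨t, htU, ht⟩ := (hev.and self_mem_nhdsWithin).exists
  have hN : linPart (0, σ t) = Matrix.single 0 1 t := by
    ext i j
    by_cases hij : (i, j) = (0, 0)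
    · obtain ⟨rfl, rfl⟩ := Prod.mk.inj hij
      simp only [linPart, σ, ne_eq, not_true_eq_false, dite_false, Prod.mk.injEq]
      rw [Finset.sum_eq_zero fun k _ => if_neg fun hk => k.2 hk.1]
      simp
    · have : linPart (0, σ t) i j = σ t ⟨(i, j), hij⟩ := dif_pos hij
      rw [this]
      simp [σ, Matrix.single_apply, eq_comm]
  have hNv : ∀ v : Fin (n + 2) → ℝ, (-Matrix.single 0 1 t) *ᵥ v =
      (-(t * v 1)) • Pi.single (0 : Fin (n + 2)) 1 := fun v => by
    rw [Matrix.neg_mulVec, Matrix.single_mulVec_eq, neg_smul]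
  have hN2 : ∀ v : Fin (n + 2) → ℝ, (-Matrix.single (0 : Fin (n + 2)) 1 t) *ᵥ
      ((-Matrix.single (0 : Fin (n + 2)) 1 t) *ᵥ v) = 0 := fun v => by
    rw [hNv v, hNv]
    simp
  have hT₀ : (expEquiv (linPart (0, σ t))).symm e₀ = e₀ := by
    rw [expEquiv_symm_apply, hN, exp_mulVec_of_mulVec_mulVec_eq_zero _ (hN2 _), hNv]
    simp [he₀]
  have hT₁ : (expEquiv (linPart (0, σ t))).symm e₁ = e₁ - t • e₀ := by
    rw [expEquiv_symm_apply, hN, exp_mulVec_of_mulVec_mulVec_eq_zero _ (hN2 _), hNv]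
    ext i
    simp [he₀, he₁, sub_eq_add_neg, Pi.single_apply]
  have hz : linPart ((0 : Fin (n + 2) → ℝ),
      (0 : {q : Fin (n + 2) × Fin (n + 2) // q ≠ (0, 0)} → ℝ)) = 0 := linPart_zero
  have hT : ∀ v, (expEquiv (linPart ((0 : Fin (n + 2) → ℝ),
      (0 : {q : Fin (n + 2) × Fin (n + 2) // q ≠ (0, 0)} → ℝ)))).symm v = v := fun v => by
    rw [hz, expEquiv_symm_apply]
    simp
  -- The right-hand sides agree at `σ t` and at 0; subtracting leaves t times two positive numbers.
  have a1 := hprop e₀ e₁ e₀ _ htU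
  have a2 := hprop e₀ e₁ e₀ _ h0
  have b1 : F e₁ e₀ (σ t) = B.1 e₁ e₀ - t * B.1 e₀ e₀ := by
    simp only [hF, hT₀, hT₁]
    simp
  have b2 : F e₀ e₀ (σ t) = B.1 e₀ e₀ := by simp only [hF, hT₀]
  have b3 : F e₁ e₀ 0 = B.1 e₁ e₀ := by simp only [hF, hT]
  have b4 : F e₀ e₀ 0 = B.1 e₀ e₀ := by simp only [hF, hT]
  rw [b1, b2] at a1
  rw [b3, b4] at a2
  have h3 : t * B.1 e₀ e₀ * F e₀ e₀ s₁ = 0 := by linarith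
  exact mul_ne_zero (mul_ne_zero ht (B.2.2 e₀ hne).ne') (hFpos hne s₁).ne' h3

/-- A field of conformal structures on `ℝ^d` is not equivariant under almost all the affine maps
close to the identity, even at a single point. -/
theorem not_ae_affine_equivariant {n : ℕ} {U : Set (Param (n + 2))} (hU : U ∈ 𝓝 0)
    (K : (Fin (n + 2) → ℝ) → CS (Euc (n + 2))) (y : Fin (n + 2) → ℝ) (c : CS (Euc (n + 2))) :
    ¬ ∀ᵐ a : Param (n + 2), a ∈ U →
      K (NormedSpace.exp (linPart a) *ᵥ y + a.1) = CS.push (expEquiv (linPart a)) c := by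
  intro h
  have hlin : ∀ a : Param (n + 2), linPart a = linPart (0, a.2) := fun a => rfl
  have hcont : Continuous fun s : {q : Fin (n + 2) × Fin (n + 2) // q ≠ (0, 0)} → ℝ =>
      NormedSpace.exp (linPart (0, s)) *ᵥ y :=
    (continuous_exp_linPart_mulVec y).comp (by fun_prop)
  -- From the image point z back to the translation: for each s this is a translation of ℝ^d. The
  -- swaps put s first, as the base of the skew product.
  have hmp : MeasurePreserving (fun q : Param (n + 2) =>
      ((q.1 - NormedSpace.exp (linPart (0, q.2)) *ᵥ y, q.2) : Param (n + 2))) volume volume := by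
    have h1 : MeasurePreserving
        (fun q : ({q : Fin (n + 2) × Fin (n + 2) // q ≠ (0, 0)} → ℝ) × (Fin (n + 2) → ℝ) =>
          (q.1, q.2 - NormedSpace.exp (linPart (0, q.1)) *ᵥ y))
        (volume.prod volume) (volume.prod volume) := by
      refine (MeasurePreserving.id volume).skew_product
        (g := fun s z => z - NormedSpace.exp (linPart (0, s)) *ᵥ y) ?_
        (ae_of_all _ fun s => (measurePreserving_sub_right volume _).map_eq)
      exact (continuous_snd.sub (hcont.comp continuous_fst)).measurable
    exact Measure.measurePreserving_swap.comp (h1.comp Measure.measurePreserving_swap)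
  have h1 := hmp.quasiMeasurePreserving.ae h
  have h2 := Measure.ae_ae_of_ae_prod (μ := (volume : Measure (Fin (n + 2) → ℝ))) h1
  -- The pair (y, 0) corresponds to the parameter 0, so a product neighbourhood of it lands in U.
  have hev : ∀ᶠ q : (Fin (n + 2) → ℝ) × ({q : Fin (n + 2) × Fin (n + 2) // q ≠ (0, 0)} → ℝ) in
      𝓝 (y, 0), ((q.1 - NormedSpace.exp (linPart (0, q.2)) *ᵥ y, q.2) : Param (n + 2)) ∈ U := by
    have hc : Continuous fun q :
        (Fin (n + 2) → ℝ) × ({q : Fin (n + 2) × Fin (n + 2) // q ≠ (0, 0)} → ℝ) =>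
        ((q.1 - NormedSpace.exp (linPart (0, q.2)) *ᵥ y, q.2) : Param (n + 2)) :=
      (continuous_fst.sub (hcont.comp continuous_snd)).prodMk continuous_snd
    refine hc.continuousAt.eventually_mem ?_
    have hz : linPart ((0 : Fin (n + 2) → ℝ),
        (0 : {q : Fin (n + 2) × Fin (n + 2) // q ≠ (0, 0)} → ℝ)) = 0 := linPart_zero
    simp only [hz, NormedSpace.exp_zero, Matrix.one_mulVec, sub_self]
    exact hU
  rw [nhds_prod_eq, eventually_prod_iff] at hev
  obtain ⟨p, hp, q, hq, hpq⟩ := hev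
  obtain ⟨z, hz, hzp⟩ : ∃ z, (∀ᵐ s : {q : Fin (n + 2) × Fin (n + 2) // q ≠ (0, 0)} → ℝ,
      (z - NormedSpace.exp (linPart (0, s)) *ᵥ y, s) ∈ U →
      K (NormedSpace.exp (linPart (z - NormedSpace.exp (linPart (0, s)) *ᵥ y, s)) *ᵥ y +
        (z - NormedSpace.exp (linPart (0, s)) *ᵥ y)) =
        CS.push (expEquiv (linPart (z - NormedSpace.exp (linPart (0, s)) *ᵥ y, s))) c) ∧ p z := by
    by_contra! hcon
    exact (Measure.measure_pos_of_mem_nhds volume hp).ne'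
      (measure_mono_null (fun z hz hz' => hcon z hz' hz) h2)
  obtain ⟨V, hVq, hV, h0V⟩ := mem_nhds_iff.1 hq
  refine not_ae_push_expEquiv_eq hV h0V c (K z) ?_
  filter_upwards [hz] with s hs hsV
  have := hs (hpq hzp (hVq hsV))
  rw [hlin] at this
  rw [← this, add_sub_cancel]

/-! ### Charts -/

section

variable {d : ℕ} {M : Type*} [TopologicalSpace M] [ChartedSpace (Euc d) M]

/-- A chart of the maximal smooth atlas is differentiable in both directions. -/
theorem mdifferentiable_of_mem_maximalAtlas {φ : OpenPartialHomeomorph M (Euc d)}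
    (hφ : φ ∈ IsManifold.maximalAtlas (𝓡 d) ∞ M) :
    φ.MDifferentiable (𝓡 d) (𝓡 d) :=
  ⟨(contMDiffOn_of_mem_maximalAtlas hφ).mdifferentiableOn (by simp),
    (contMDiffOn_symm_of_mem_maximalAtlas hφ).mdifferentiableOn (by simp)⟩

/-- A section of `CS(TM)` read in a chart. -/
theorem exists_chart_representative {φ : OpenPartialHomeomorph M (Euc d)}
    (hφ : φ.MDifferentiable (𝓡 d) (𝓡 d)) (C : (x : M) → CS (TangentSpace (𝓡 d) x))
    (c₀ : CS (Euc d)) :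
    ∃ K : Euc d → CS (Euc d), ∀ (x : M) (hx : x ∈ φ.source),
      K (φ x) = CS.push (hφ.mfderiv hx) (C x) := by
  classical
  -- Injectivity of φ makes the chosen preimage harmless; `c₀` is a filler off the image of the
  -- chart.
  refine ⟨fun z => if h : ∃ x, ∃ _ : x ∈ φ.source, φ x = z then
    CS.push (hφ.mfderiv h.choose_spec.choose) (C h.choose) else c₀, fun x hx => ?_⟩
  have h : ∃ x', ∃ _ : x' ∈ φ.source, φ x' = φ x := ⟨x, hx, rfl⟩
  dsimp only
  rw [dif_pos h]
  have e : h.choose = x := φ.injOn h.choose_spec.choose hx h.choose_spec.choose_spec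
  have key : ∀ (x' : M) (hx' : x' ∈ φ.source), x' = x →
      (CS.push (hφ.mfderiv hx') (C x') : CS (Euc d)) = CS.push (hφ.mfderiv hx) (C x) := by
    rintro x' hx' rfl
    rfl
  exact key _ _ e

/-- The derivative of a diffeomorphism which is affine in a chart. -/
theorem deriv_trans_mfderiv {φ : OpenPartialHomeomorph M (Euc d)}
    (hφ : φ.MDifferentiable (𝓡 d) (𝓡 d)) (f : Diff d M) (T : Euc d ≃L[ℝ] Euc d) (b : Euc d)
    {x : M} (hx : x ∈ φ.source) (hfx : f x ∈ φ.source)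
    (h : ∀ᶠ y in 𝓝 x, φ (f y) = T (φ y) + b) :
    (deriv f x).trans (hφ.mfderiv hfx) = (hφ.mfderiv hx).trans T := by
  -- Differentiate φ ∘ f in two ways, by the chain rule and through the affine expression, and
  -- compare.
  have h1 : HasMFDerivAt (𝓡 d) (𝓡 d) (fun y => φ (f y)) x
      ((mfderiv (𝓡 d) (𝓡 d) φ (f x)).comp (mfderiv (𝓡 d) (𝓡 d) f x)) :=
    HasMFDerivAt.comp x (hφ.mdifferentiableAt hfx).hasMFDerivAt
      ((f.mdifferentiable (by simp)) x).hasMFDerivAt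
  have h2 : HasMFDerivAt (𝓡 d) (𝓡 d) (fun y => T (φ y) + b) x
      ((T : Euc d →L[ℝ] Euc d).comp (mfderiv (𝓡 d) (𝓡 d) φ x)) := by
    have h3 : HasFDerivAt (fun z => T z + b) (T : Euc d →L[ℝ] Euc d) (φ x) :=
      T.hasFDerivAt.add_const b
    exact HasMFDerivAt.comp (g := fun z => T z + b) x h3.hasMFDerivAt
      (hφ.mdifferentiableAt hx).hasMFDerivAt
  have h4 := hasMFDerivAt_unique (h1.congr_of_eventuallyEq (h.mono fun y hy => hy.symm)) h2
  exact ContinuousLinearEquiv.ext (funext fun v => congrArg (fun L => L v) h4)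

end

/-! ### The law of the random walk -/

variable {n : ℕ} {M : Type*} [TopologicalSpace M] [ChartedSpace (Euc (n + 2)) M]
  [IsManifold (𝓡 (n + 2)) ∞ M] [MeasurableSpace M] [BorelSpace M] {g : Metric (n + 2) M}

theorem cube_eq (d : ℕ) [NeZero d] (ε : ℝ) :
    cube d ε = (univ.pi fun _ => Icc (-ε) ε) ×ˢ (univ.pi fun _ => Icc (-ε) ε) := by
  ext a
  simp only [cube, abs_le, mem_ofPred_eq, mem_prod, mem_univ_pi, mem_Icc]

theorem isCompact_cube (d : ℕ) [NeZero d] (ε : ℝ) : IsCompact (cube d ε) := by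
  rw [cube_eq]
  exact (isCompact_univ_pi fun _ => isCompact_Icc).prod (isCompact_univ_pi fun _ => isCompact_Icc)

theorem cube_mem_nhds (d : ℕ) [NeZero d] {ε : ℝ} (hε : 0 < ε) : cube d ε ∈ 𝓝 (0 : Param d) := by
  rw [cube_eq]
  have h : Icc (-ε) ε ∈ 𝓝 (0 : ℝ) := Icc_mem_nhds (by linarith) hε
  exact prod_mem_nhds (set_pi_mem_nhds finite_univ fun _ _ => h)
    (set_pi_mem_nhds finite_univ fun _ _ => h)

/-- A property of almost every element of the random walk holds for almost every perturbation. -/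
theorem ae_of_ae_law (P : Perturbations g) (f₀ : Diff (n + 2) M) {ε : ℝ}
    (hP : cube (n + 2) ε ⊆ P.dom) {p₀ : ℝ≥0} {p : Fin P.j → ℝ≥0} (hp : ∀ i, 0 < p i)
    {Q : Diff (n + 2) M → Prop} (h : ∀ᵐ f ∂law P f₀ ε p₀ p, Q f) (i : Fin P.j) :
    ∀ᵐ a, a ∈ cube (n + 2) ε → Q (f₀.trans (P.diffeo i a)) := by
  -- Finite mass makes the normalizing factor nonzero, so null sets for the law are null before
  -- normalization.
  have hfin : unnormalizedLaw P f₀ ε p₀ p univ ≠ ⊤ := by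
    have : IsFiniteMeasure (volume.restrict (cube (n + 2) ε)) :=
      ⟨by simpa using (isCompact_cube (n + 2) ε).measure_lt_top⟩
    have : IsFiniteMeasure (unnormalizedLaw P f₀ ε p₀ p) := by
      unfold unnormalizedLaw
      infer_instance
    exact measure_ne_top _ _
  have h1 : ∀ᵐ f ∂unnormalizedLaw P f₀ ε p₀ p, Q f := by
    rwa [law, Measure.ae_ennreal_smul_measure_iff (ENNReal.inv_ne_zero.2 hfin)] at h
  have h2 : ∀ᵐ f ∂(p i • (volume.restrict (cube (n + 2) ε)).map fun a =>
      f₀.trans (P.diffeo i a)), Q f := by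
    refine ae_mono (le_trans ?_ (Measure.le_add_left le_rfl)) h1
    exact Finset.single_le_sum (f := fun i => p i • (volume.restrict (cube (n + 2) ε)).map
      fun a => f₀.trans (P.diffeo i a)) (fun _ _ => Measure.zero_le _) (Finset.mem_univ i)
  rw [Measure.ae_smul_measure_iff (hp i).ne'] at h2
  have hm := (isCompact_cube (n + 2) ε).measurableSet
  exact (ae_restrict_iff' hm).1 (ae_of_ae_map (P.aemeasurable_diffeo f₀ hP hm i) h2)

/-- The random walk preserves no conformal structure, with respect to any probability measure: the
section `C` is defined everywhere, the images of a single point under the perturbations are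
distributed with a density, and at almost all of these images, almost all the unimodular matrices
close to the identity occur as linear parts. -/
theorem not_isInvariantConformalStructure_law (P : Perturbations g) (f₀ : Diff (n + 2) M) {ε : ℝ}
    (hε : 0 < ε) (hP : cube (n + 2) ε ⊆ P.dom) {p₀ : ℝ≥0} {p : Fin P.j → ℝ≥0} (hp : ∀ i, 0 < p i)
    (ν : Measure M) [IsProbabilityMeasure ν] (C : (x : M) → CS (TangentSpace (𝓡 (n + 2)) x)) :
    ¬ IsInvariantConformalStructure (law P f₀ ε p₀ p) ν C := by
  rintro ⟨-, hC⟩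
  obtain ⟨x, hx⟩ := hC.exists
  obtain ⟨i, hi, hiy⟩ := P.cover (f₀ x)
  have hae := ae_of_ae_law P f₀ hP hp hx i
  have hφ := mdifferentiable_of_mem_maximalAtlas (P.φ_smooth i)
  obtain ⟨c, hc⟩ : ∃ c, c = CS.push (deriv f₀ x) (C x) := ⟨_, rfl⟩
  obtain ⟨K, hK⟩ := exists_chart_representative hφ C (CS.push (hφ.mfderiv hi) c)
  have h0 : (0 : Param (n + 2)) ∈ P.dom := hP (mem_of_mem_nhds (cube_mem_nhds _ hε))
  refine not_ae_affine_equivariant (inter_mem (cube_mem_nhds (n + 2) hε)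
    (P.eventually_ψ_one_eq h0)) (fun z => K (WithLp.toLp 2 z)) (P.φ i (f₀ x)).ofLp
    (CS.push (hφ.mfderiv hi) c) ?_
  filter_upwards [hae] with a ha haU
  obtain ⟨haε, haψ⟩ := haU
  have hmem : ∀ y ∈ (P.φ i).source, P.ψ a 1 (P.φ i y) ∈ (P.φ i).target := fun y hy => by
    rw [P.φ_target]
    exact P.ψ_one_mem_ball (hP haε) (P.φ_target i ▸ (P.φ i).map_source hy)
  have hsrc : P.diffeo i a (f₀ x) ∈ (P.φ i).source := by
    rw [P.diffeo_chart i a (hP haε) _ hi]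
    exact (P.φ i).map_target (hmem _ hi)
  -- The affine formula is needed near f₀ x, not only at it, since it also determines the
  -- derivative.
  have hloc : ∀ y ∈ (P.φ i).source, P.φ i y ∈ Metric.ball (0 : Euc (n + 2)) (1 / 2) →
      P.φ i (P.diffeo i a y) = expEquiv (linPart a) (P.φ i y) + WithLp.toLp 2 a.1 := by
    intro y hy hy'
    rw [P.diffeo_chart i a (hP haε) _ hy, (P.φ i).right_inv (hmem y hy), haψ _ hy',
      expEquiv_apply, WithLp.toLp_add]
  have hder := deriv_trans_mfderiv hφ (P.diffeo i a) (expEquiv (linPart a)) (WithLp.toLp 2 a.1)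
    hi hsrc (by
      filter_upwards [(P.φ i).open_source.mem_nhds hi,
        ((P.φ i).continuousAt hi).eventually (Metric.isOpen_ball.mem_nhds hiy)] with y hy hy'
      exact hloc y hy hy')
  have hchain : deriv (f₀.trans (P.diffeo i a)) x =
      (deriv f₀ x).trans (deriv (P.diffeo i a) (f₀ x)) := by
    exact ContinuousLinearEquiv.ext (funext fun v => congrArg (fun L => L v)
      (mfderiv_comp x ((P.diffeo i a).mdifferentiable (by simp) _)
        (f₀.mdifferentiable (by simp) x)))
  have hz : P.φ i (P.diffeo i a (f₀ x)) = WithLp.toLp 2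
      (NormedSpace.exp (linPart a) *ᵥ (P.φ i (f₀ x)).ofLp + a.1) := by
    rw [hloc _ hi hiy, expEquiv_apply, WithLp.toLp_add]
  have hCa : C (P.diffeo i a (f₀ x)) = CS.push (deriv (P.diffeo i a) (f₀ x)) c := by
    rw [hc, ← CS.push_trans, ← hchain]
    exact ha haε
  have hpush : CS.push (hφ.mfderiv hsrc) (CS.push (deriv (P.diffeo i a) (f₀ x)) c) =
      CS.push (expEquiv (linPart a)) (CS.push (hφ.mfderiv hi) c) :=
    (CS.push_trans _ _ _).symm.trans
      ((congrArg (fun L => CS.push L c) hder).trans (CS.push_trans _ _ _))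
  -- K at the affine image of y is C at the perturbed point read in the chart; invariance and the
  -- chain rule make it A_a c.
  exact (congrArg K hz.symm).trans ((hK _ hsrc).trans ((congrArg _ hCa).trans hpush))

end RandomWalk
end

theorem mainTheorem8 {n : ℕ} {M : Type*} [TopologicalSpace M] [T2Space M] [CompactSpace M]
    [ChartedSpace (RandomWalk.Euc (n + 2)) M] [IsManifold (𝓡 (n + 2)) ∞ M]
    [MeasurableSpace M] [BorelSpace M]
    (g : RandomWalk.Metric (n + 2) M) (P : RandomWalk.Perturbations g)
    (f₀ : RandomWalk.Diff (n + 2) M)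
    (hf₀ : MeasurePreserving f₀ (RandomWalk.vol g) (RandomWalk.vol g))
    (ε : ℝ) (hε : 0 < ε) (hε' : ε < 1 / 2) (hP : RandomWalk.cube (n + 2) ε ⊆ P.dom)
    (p₀ : ℝ≥0) (p : Fin P.j → ℝ≥0) (hp₀ : 0 < p₀) (hp : ∀ i, 0 < p i) (hsum : p₀ + ∑ i, p i = 1)
    (ν : Measure M) (hν : RandomWalk.IsStationary (RandomWalk.law P f₀ ε p₀ p) ν)
    (ν₀ ν' : Measure M) (hdec : ν = ν₀ + ν') (hac : ν₀ ≪ RandomWalk.vol g) (hne : ν₀ ≠ 0) :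
    ¬ ∃ C : (x : M) → RandomWalk.CS (TangentSpace (𝓡 (n + 2)) x),
      RandomWalk.IsInvariantConformalStructure (RandomWalk.law P f₀ ε p₀ p) ν C := by
  rintro ⟨C, hC⟩
  have := hν.1
  exact RandomWalk.not_isInvariantConformalStructure_law P f₀ hε hP hp ν C hC
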